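/- Let \(G\) be a finite graph. For vertices \(v,w\) put \(d(v,w)=0\) if \(v=w\), \(d(v,w)=1\) if \(v\sim w\), and \(d(v,w)=\infty\) otherwise, and for words \(x,y\in V(G)^n\) put \(d(x,y)=\sum_{j=1}^n d(x_j,y_j)\). For real \(r\) let \(G(n,r)\) be the graph on \(V(G)^n\) in which two distinct words \(x,y\) are adjacent iff \(d(x,y)\le r\). With \(\alpha\) the independence number, let \[R^*(G,\delta)=\limsup_{n\to\infty}\frac1n\log\alpha(G(n,\delta n)).\] Let \(\theta_L(G)\) be the Lovász theta function, i.e. the minimum of \(\max_v D_{v,v}\) over real symmetric matrices \(D\) indexed by \(V(G)\) such that \(D-J\) is positive semidefinite (\(J\) the all-ones matrix) and \(D_{v,w}=0\) for all distinct non-adjacent \(v,w\). For real \(s\ge2\) put \(H_s(x)=x\log(s-1)-x\log x-(1-x)\log(1-x)\) (with \(0\log 0=0\)) and \[R_{LP1}(s,\delta)=H_s\!\left(\frac{(s-1)-(s-2)\delta-2\sqrt{(s-1)\delta(1-\delta)}}{s}\right)\ \text{ for } 0\le\delta<1-\tfrac1s,\qquad R_{LP1}(s,\delta)=0\ \text{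 for }\delta\ge1-\tfrac1s.\] **Theorem.** Let \(q\ge3\) be odd, let \(C_q\) be the cycle on \(q\) vertices, and let \(q'=1+\frac1{\cos(\pi/q)}\). Then \(q'\le q\), \(q'\) is not an integer if \(q>3\), and for every real \(\delta\ge0\) \[R^*(C_q,\delta)\le\log\theta_L(C_q)+R_{LP1}(q',\delta).\] In particular, for the pentagon \(q'=\sqrt5\) and, for every real \(\delta\ge0\), \[R^*(C_5,\delta)\le\tfrac12\log5+R_{LP1}(\sqrt5,\delta).\] -/

import Mathlib

namespace CycleCodes

open Classical in
/-- The semimetric on the vertices of a graph: `0` for equal vertices, `1` for adjacent ones and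
`∞` otherwise. -/
noncomputable def vdist {V : Type*} (G : SimpleGraph V) (v w : V) : ENNReal :=
  if v = w then 0 else if G.Adj v w then 1 else ⊤

/-- The additive extension of the semimetric `vdist G` to words of length `n`. -/
noncomputable def wdist {V : Type*} (G : SimpleGraph V) {n : ℕ} (x y : Fin n → V) : ENNReal :=
  ∑ j, vdist G (x j) (y j)

theorem vdist_comm {V : Type*} (G : SimpleGraph V) (v w : V) : vdist G v w = vdist G w v := by
  unfold vdist
  rw [G.adj_comm v w]
  by_cases h : v = w
  · simp [h]
  · simp [h, Ne.symm h]

theorem wdist_comm {V : Type*} (G : SimpleGraph V) {n : ℕ} (x y : Fin n → V) :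
    wdist G x y = wdist G y x := by
  simp only [wdist, vdist_comm G (x _) (y _)]

/-- The graph `G(n, d)` on the words of length `n`: distinct words are adjacent when their
distance is at most `d`. (For `d < 0` there are no edges, since distinct words are at positive
distance.) -/
def powGraph {V : Type*} (G : SimpleGraph V) (n : ℕ) (d : ℝ) : SimpleGraph (Fin n → V) where
  Adj x y := x ≠ y ∧ wdist G x y ≤ ENNReal.ofReal d
  symm := ⟨fun x y h => ⟨h.1.symm, by rw [wdist_comm]; exact h.2⟩⟩
  loopless := ⟨fun _ h => h.1 rfl⟩

/-- The rate `R^*(G, δ) = limsup (1/n) log α(G(n, δ n))`. For a finite nonempty vertex set `V` the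
sequence takes its values in `[0, log |V|]`. -/
noncomputable def rate {V : Type*} (G : SimpleGraph V) (δ : ℝ) : ℝ :=
  Filter.limsup (fun n : ℕ => 1 / (n : ℝ) * Real.log ((powGraph G n (δ * n)).indepNum : ℝ)) Filter.atTop

/-- The Lovász theta function of a finite graph: the minimum of `max_v D_{v,v}` over the real symmetric matrices `D`
with `D ⪰ J` (`J` the all-ones matrix) that vanish on the edges of the complement of `G`. -/
noncomputable def thetaL {V : Type*} (G : SimpleGraph V) : ℝ :=
  sInf {t : ℝ | ∃ D : Matrix V V ℝ,
    (D - Matrix.of fun _ _ => (1 : ℝ)).PosSemidef ∧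
    (∀ v w, Gᶜ.Adj v w → D v w = 0) ∧
    t = ⨆ v, D v v}

/-- The `q`-ary entropy function, for a real parameter `q`. -/
noncomputable def Hq (q x : ℝ) : ℝ :=
  x * Real.log (q - 1) - x * Real.log x - (1 - x) * Real.log (1 - x)

/-- The first linear programming bound, for a real parameter `q`. -/
noncomputable def RLP1 (q δ : ℝ) : ℝ :=
  if δ < 1 - 1 / q then
    Hq q (((q - 1) - (q - 2) * δ - 2 * √((q - 1) * δ * (1 - δ))) / q)
  else 0

/-- The parameter `q' = 1 + 1 / cos (π / q)`. -/
noncomputable def qprime (q : ℕ) : ℝ := 1 + 1 / Real.cos (Real.pi / q)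

end CycleCodes

/-!
Write `s = q'`, `c = cos (π / q)` and let `A` be the adjacency matrix of `C_q`. The matrix
`N₀ = I + A / (2 c)` is, up to scaling, the optimal solution of the program that defines the theta
function: `N₀ ⪰ (s / q) J`. Since `s - 1 = 1 / c`, the matrix `N₁ = (s - 1) I - A / (2 c)` is
positive semidefinite as well. Thus the spectrum of `A / (2 c)` lies in `[-1, s - 1]`, and the two
endpoints are exactly the values of the Hamming scheme "over an alphabet of size `s`". This is what
makes the linear programming bound for the non-integral alphabet size `s` apply to `C_q`.

For words `x, y` and a set `a` of coordinates let `K a x y = ∏ j ∈ a, χ (x j) (y j)`, where `χ` is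
`s - 1` on equal letters and `-1` on different ones, so that `χ² = (s - 1) + (s - 2) χ`, and
let `W x y = ∏ j, N₀ (x j) (y j)`. The kernel `W` is nonnegative and vanishes at infinite distance.
Coordinatewise `N₀ χ = N₁` and `N₀ χ² = (s - 1) N₀ + (s - 2) N₁`, hence by the Schur product theorem
all the kernels `W * K a * K a'` are positive semidefinite, and for `a = a'` they dominate
`(s / q) ^ n (s - 1) ^ #a J` (`sum_twisted_lower_bound`). For a radial function `φ ≥ 0` supported on
sets of at most `r = ρ n` coordinates, the kernel
`W * (∑ j, χ - λ') * (∑ a, φ #a * K a) ^ 2` with `λ' = (s - 1) n - s d` is nonpositive at distances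
above `d`. If `φ` satisfies `T φ ≥ λ φ` pointwise for the Krawtchouk operator `T` and some `λ > λ'`,
the expansion of this kernel in the products `W * K a * K a'` has nonnegative coefficients. Summing
the kernel over a code and using the Cauchy–Schwarz inequality bounds the size of the code by
`(q / s) ^ n` times the `s`-ary volume of a ball of radius `r`, up to the factor
`s d / (λ - λ')` (`pow_mul_card_mul_le`). No zeros of Krawtchouk polynomials are needed: the scaled
sine arch `sineArch` is an explicit choice of `φ`, with `λ / n` close to
`2 √((s - 1) ρ (1 - ρ)) + (s - 2) ρ` (`mul_sineArch_le_krawOp`). This exceeds `λ' / n` as soon as `ρ`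
is above the argument of the entropy function in the first linear programming bound
(`lt_of_optimalRadius_lt`), and continuity of the entropy gives the rate bound with
`log (q / s)` in place of `log θ_L`. Finally `q / s ≤ θ_L` by weak duality
(`div_qprime_le_thetaL`), and for the pentagon `5 / √5 = √5`.
-/

section

open Finset Real Filter Topology

/-! ### Positive semidefinite kernels on words -/

/-- The Schur product theorem, in the form that `A ⪰ c J` and `B ⪰ d J` imply `A ∘ B ⪰ c d J`, by
`A ∘ B - c d J = (A - c J) ∘ (B - d J) + c (B - d J) + d (A - c J)`. -/
theorem posSemidef_hadamard_sub {W : Type*} [Fintype W] {A B : Matrix W W ℝ} {c d : ℝ}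
    (hc : 0 ≤ c) (hd : 0 ≤ d) (hA : (A - Matrix.of fun _ _ => c).PosSemidef)
    (hB : (B - Matrix.of fun _ _ => d).PosSemidef) :
    (A.hadamard B - Matrix.of fun _ _ => c * d).PosSemidef := by
  have e : A.hadamard B - Matrix.of (fun _ _ => c * d) =
      (A - Matrix.of fun _ _ => c).hadamard (B - Matrix.of fun _ _ => d) +
        c • (B - Matrix.of fun _ _ => d) + d • (A - Matrix.of fun _ _ => c) := by
    ext x y
    simp only [Matrix.sub_apply, Matrix.add_apply, Matrix.hadamard_apply, Matrix.of_apply,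
      Matrix.smul_apply, smul_eq_mul]
    ring
  rw [e]
  exact ((hA.hadamard hB).add (hB.smul hc)).add (hA.smul hd)

theorem posSemidef_prod_sub {V : Type*} [Fintype V] {n : ℕ} (N : Fin n → Matrix V V ℝ)
    (c : Fin n → ℝ) (hc : ∀ j, 0 ≤ c j)
    (hN : ∀ j, (N j - Matrix.of fun _ _ => c j).PosSemidef) (s : Finset (Fin n)) :
    (Matrix.of (fun x y : Fin n → V => ∏ j ∈ s, N j (x j) (y j)) -
      Matrix.of fun _ _ => ∏ j ∈ s, c j).PosSemidef := by
  induction s using Finset.induction_on with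
  | empty =>
    convert (Matrix.PosSemidef.zero (n := Fin n → V) (R := ℝ)) using 1
    ext x y
    simp
  | insert j s hj ih =>
    have h1 := (hN j).submatrix (fun x : Fin n → V => x j)
    have h := posSemidef_hadamard_sub
      (A := (N j).submatrix (fun x : Fin n → V => x j) (fun x => x j)) (hc j) (prod_nonneg fun i _ => hc i) h1 ih
    convert h using 1
    ext x y
    simp [Matrix.hadamard_apply, prod_insert hj]

theorem posSemidef_sum_nonneg {W : Type*} [Fintype W] {A : Matrix W W ℝ} (hA : A.PosSemidef)
    (u : W → ℝ) : 0 ≤ ∑ x, ∑ y, u x * A x y * u y := by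
  have h := hA.dotProduct_mulVec_nonneg u
  simpa [dotProduct, Matrix.mulVec, mul_sum, mul_assoc] using h

/-- A product kernel whose factors dominate `c j • J` (with `J` the all-ones matrix) dominates
`(∏ j, c j) • J`, tested on the indicator vector of a set of words. -/
theorem prod_mul_card_sq_le_sum_prod {V : Type*} [Fintype V] {n : ℕ} (N : Fin n → Matrix V V ℝ)
    (c : Fin n → ℝ) (hc : ∀ j, 0 ≤ c j)
    (hN : ∀ j, (N j - Matrix.of fun _ _ => c j).PosSemidef) (S : Finset (Fin n → V)) :
    (∏ j, c j) * (#S : ℝ) ^ 2 ≤ ∑ x ∈ S, ∑ y ∈ S, ∏ j, N j (x j) (y j) := by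
  classical
  have h := posSemidef_sum_nonneg (posSemidef_prod_sub N c hc hN univ)
    (fun x => if x ∈ S then 1 else 0)
  simp only [Matrix.sub_apply, Matrix.of_apply, ite_mul, one_mul, zero_mul, mul_ite, mul_one,
    mul_zero, sum_ite_mem, univ_inter] at h
  have h2 : (∑ x : Fin n → V, ∑ y ∈ S, if x ∈ S then (∏ j, N j (x j) (y j)) - ∏ j, c j else 0)
      = ∑ x ∈ S, ∑ y ∈ S, ∏ j, N j (x j) (y j) - (∏ j, c j) * (#S : ℝ) ^ 2 := by
    rw [← sum_filter_add_sum_filter_not univ (· ∈ S)]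
    rw [add_eq_left.2 (sum_eq_zero fun x hx => sum_eq_zero fun y _ => if_neg (mem_filter.1 hx).2)]
    rw [filter_mem_eq_inter, univ_inter, sum_congr rfl fun x hx =>
      sum_congr rfl fun y _ => if_pos hx]
    simp only [sum_sub_distrib, sum_const, nsmul_eq_mul]
    ring
  linarith

/-! ### Products of characters and the Krawtchouk operator -/

/-- The first Krawtchouk operator of the Hamming scheme of length `n` with real alphabet size `s`, on
radial functions: multiplication by `∑ j, χ j` in terms of the coefficients of character sums, see
`sum_mul_sum_character`. At `k = 0` the truncated `k - 1` is harmless since its coefficient is `0`. -/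
noncomputable def krawOp (s : ℝ) (n : ℕ) (φ : ℕ → ℝ) (k : ℕ) : ℝ :=
  ((n : ℝ) - k) * (s - 1) * φ (k + 1) + k * φ (k - 1) + k * (s - 2) * φ k

/-- The sum over all sets, grouped into the pairs `a`, `insert i a`. -/
theorem sum_finset_eq_sum_notMem {n : ℕ} (i : Fin n) (F : Finset (Fin n) → ℝ) :
    ∑ a, F a = ∑ a with i ∉ a, (F a + F (insert i a)) := by
  rw [sum_add_distrib, ← sum_filter_add_sum_filter_not univ (fun a => i ∉ a)]
  congr 1
  refine sum_nbij' (fun a => a.erase i) (fun a => insert i a) ?_ ?_ ?_ ?_ ?_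
  · simp
  · simp
  · intro a ha
    simp only [mem_filter, not_not] at ha
    exact insert_erase ha.2
  · intro a ha
    simp only [mem_filter] at ha
    exact erase_insert ha.2
  · intro a ha
    simp only [mem_filter, not_not] at ha
    rw [insert_erase ha.2]

/-- Multiplication by a single `χ i`: a character without the factor `χ i` gains it, and in the other
characters `χ i ^ 2` is expanded. -/
theorem mul_sum_character {n : ℕ} {s : ℝ} (χ : Fin n → ℝ)
    (hχ : ∀ j, χ j ^ 2 = (s - 1) + (s - 2) * χ j) (φ : ℕ → ℝ) (i : Fin n) :
    χ i * ∑ a : Finset (Fin n), φ #a * ∏ j ∈ a, χ j =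
      ∑ a : Finset (Fin n), (if i ∈ a then φ (#a - 1) + (s - 2) * φ #a
        else (s - 1) * φ (#a + 1)) * ∏ j ∈ a, χ j := by
  rw [sum_finset_eq_sum_notMem i, sum_finset_eq_sum_notMem i (fun a => _ * _), mul_sum]
  refine sum_congr rfl fun a ha => ?_
  have ha : i ∉ a := (mem_filter.1 ha).2
  simp only [ha, if_false, mem_insert_self, if_true, prod_insert ha, card_insert_of_notMem ha,
    Nat.add_sub_cancel]
  linear_combination (φ (#a + 1) * ∏ j ∈ a, χ j) * hχ i

theorem sum_mul_sum_character {n : ℕ} {s : ℝ} (χ : Fin n → ℝ)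
    (hχ : ∀ j, χ j ^ 2 = (s - 1) + (s - 2) * χ j) (φ : ℕ → ℝ) :
    (∑ i, χ i) * ∑ a : Finset (Fin n), φ #a * ∏ j ∈ a, χ j =
      ∑ a : Finset (Fin n), krawOp s n φ #a * ∏ j ∈ a, χ j := by
  rw [sum_mul, sum_congr rfl fun i _ => mul_sum_character χ hχ φ i, sum_comm]
  refine sum_congr rfl fun a _ => ?_
  rw [← sum_mul, sum_ite]
  have h1 : (univ.filter fun i => i ∈ a) = a := by ext; simp
  have h2 : #(univ.filter fun i => i ∉ a) = n - #a := by
    have : (univ.filter fun i => i ∉ a) = aᶜ := by ext; simp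
    rw [this, card_compl, Fintype.card_fin]
  have h3 : #a ≤ n := by simpa using card_le_univ a
  rw [h1, sum_const, sum_const, h2, nsmul_eq_mul, nsmul_eq_mul, Nat.cast_sub h3, krawOp]
  ring

/-! ### The linear programming bound for codes of a given size -/

/-- The nontrivial character of the Hamming scheme of length one with real alphabet size `s`, as a
function of a pair of letters: `s - 1` on equal letters and `-1` on different ones. -/
noncomputable def coordChar {V : Type*} [DecidableEq V] (s : ℝ) (v w : V) : ℝ :=
  if v = w then s - 1 else -1

theorem coordChar_sq {V : Type*} [DecidableEq V] (s : ℝ) (v w : V) :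
    coordChar s v w ^ 2 = (s - 1) + (s - 2) * coordChar s v w := by
  unfold coordChar
  split_ifs <;> ring

section Kernel

variable {V : Type*} [DecidableEq V] (G : SimpleGraph V) [DecidableRel G.Adj]

/-- The kernel `I + β A` on letters, multiplied entrywise by `coordChar s` once for each of the
propositions `p`, `p'` that holds. -/
noncomputable def twistedKernel (s β : ℝ) (p p' : Prop) [Decidable p] [Decidable p'] :
    Matrix V V ℝ :=
  Matrix.of fun v w => (1 + β • G.adjMatrix ℝ) v w * (if p then coordChar s v w else 1) *
    (if p' then coordChar s v w else 1)

/-- With one character the kernel `I + β A` becomes `(s - 1) I - β A`, with two characters it becomes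
`(s - 1) (I + β A) + (s - 2) ((s - 1) I - β A)`. -/
theorem twistedKernel_sub_posSemidef {s β κ : ℝ} (hs : 2 ≤ s)
    (h0 : (1 + β • G.adjMatrix ℝ - Matrix.of fun _ _ => κ).PosSemidef)
    (h1 : ((s - 1) • (1 : Matrix V V ℝ) - β • G.adjMatrix ℝ).PosSemidef)
    (p p' : Prop) [Decidable p] [Decidable p'] :
    (twistedKernel G s β p p' - Matrix.of fun _ _ =>
      if p then (if p' then (s - 1) * κ else 0) else (if p' then 0 else κ)).PosSemidef := by
  by_cases hp : p <;> by_cases hp' : p'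
  · have h := (h0.smul (show 0 ≤ s - 1 by linarith)).add (h1.smul (show 0 ≤ s - 2 by linarith))
    convert h using 1
    ext v w
    by_cases hvw : v = w
    · simp [twistedKernel, hp, hp', coordChar, hvw]
      ring
    · simp only [twistedKernel, hp, hp', coordChar, hvw, Matrix.sub_apply, Matrix.add_apply,
        Matrix.of_apply, Matrix.smul_apply, smul_eq_mul, if_true, if_false, ne_eq,
        not_false_eq_true, Matrix.one_apply_ne]
      ring
  · convert h1 using 1
    ext v w
    by_cases hvw : v = w
    · simp [twistedKernel, hp, hp', coordChar, hvw]
    · simp [twistedKernel, hp, hp', coordChar, hvw]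
  · convert h1 using 1
    ext v w
    by_cases hvw : v = w
    · simp [twistedKernel, hp, hp', coordChar, hvw]
    · simp [twistedKernel, hp, hp', coordChar, hvw]
  · convert h0 using 1
    ext v w
    simp [twistedKernel, hp, hp']

/-- The product kernels twisted by two characters have nonnegative sums over every code, and for equal
characters the sum has the expected main term. -/
theorem sum_twisted_lower_bound [Fintype V] {s β κ : ℝ} (hs : 2 ≤ s) (hκ : 0 ≤ κ)
    (h0 : (1 + β • G.adjMatrix ℝ - Matrix.of fun _ _ => κ).PosSemidef)
    (h1 : ((s - 1) • (1 : Matrix V V ℝ) - β • G.adjMatrix ℝ).PosSemidef)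
    {n : ℕ} (S : Finset (Fin n → V)) (a a' : Finset (Fin n)) :
    (if a = a' then κ ^ n * (s - 1) ^ #a * (#S : ℝ) ^ 2 else 0) ≤
      ∑ x ∈ S, ∑ y ∈ S, (∏ j, (1 + β • G.adjMatrix ℝ) (x j) (y j)) *
        (∏ j ∈ a, coordChar s (x j) (y j)) * ∏ j ∈ a', coordChar s (x j) (y j) := by
  have hs1 : 0 ≤ s - 1 := by linarith
  have h := prod_mul_card_sq_le_sum_prod
    (fun j => twistedKernel G s β (j ∈ a) (j ∈ a'))
    (fun j => if j ∈ a then (if j ∈ a' then (s - 1) * κ else 0) else (if j ∈ a' then 0 else κ))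
    (fun j => by split_ifs <;> positivity)
    (fun j => twistedKernel_sub_posSemidef G hs h0 h1 _ _) S
  have e : ∀ x y : Fin n → V, ∏ j, twistedKernel G s β (j ∈ a) (j ∈ a') (x j) (y j) =
      (∏ j, (1 + β • G.adjMatrix ℝ) (x j) (y j)) *
        (∏ j ∈ a, coordChar s (x j) (y j)) * ∏ j ∈ a', coordChar s (x j) (y j) := by
    intro x y
    simp only [twistedKernel, Matrix.of_apply, prod_mul_distrib]
    simp
  simp only [e] at h
  refine le_trans ?_ h
  split_ifs with haa
  · subst haa
    refine le_of_eq ?_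
    congr 1
    have : ∀ j, (if j ∈ a then (if j ∈ a then (s - 1) * κ else 0) else
        (if j ∈ a then 0 else κ)) = (if j ∈ a then (s - 1) else 1) * κ := by
      intro j
      split_ifs <;> simp
    rw [prod_congr rfl fun j _ => this j, prod_mul_distrib]
    simp [mul_comm]
  · refine mul_nonneg (prod_nonneg fun j _ => ?_) (sq_nonneg _)
    split_ifs <;> positivity

/-- Two words with nonzero kernel value are at finite distance, which is then the number of
coordinates where they differ. -/
theorem wdist_eq_of_prod_ne_zero {β : ℝ} {n : ℕ} {x y : Fin n → V}
    (h : (∏ j, (1 + β • G.adjMatrix ℝ) (x j) (y j)) ≠ 0) :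
    CycleCodes.wdist G x y = #{j | x j ≠ y j} := by
  rw [CycleCodes.wdist, card_filter, Nat.cast_sum]
  refine sum_congr rfl fun j _ => ?_
  have hj := prod_ne_zero_iff.1 h j (mem_univ j)
  by_cases hxy : x j = y j
  · simp [CycleCodes.vdist, hxy]
  · have : G.Adj (x j) (y j) := by
      by_contra hc
      exact hj (by simp [hxy, hc])
    simp [CycleCodes.vdist, hxy, this]

theorem sum_coordChar {s : ℝ} {n : ℕ} (x y : Fin n → V) :
    ∑ j, coordChar s (x j) (y j) = (s - 1) * n - s * #{j | x j ≠ y j} := by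
  have : ∀ j, coordChar s (x j) (y j) = (s - 1) - s * (if x j ≠ y j then 1 else 0) := by
    intro j
    by_cases h : x j = y j <;> simp [coordChar, h]
  rw [sum_congr rfl fun j _ => this j, sum_sub_distrib, ← mul_sum, card_filter]
  simp
  ring

/-- The linear programming bound in finite form. The test function
`(∑ j, χ j - λ') * (∑ a, φ #a * ∏ j ∈ a, χ j) ^ 2`, where `λ' = (s - 1) * n - s * d`, is nonpositive
at distances above `d`, and its coefficients are nonnegative since `φ` is an approximate
eigenfunction of the Krawtchouk operator for a value above `λ'`. -/
theorem pow_mul_card_mul_le [Fintype V] {s β κ d lam : ℝ} (hs : 2 ≤ s) (hβ : 0 ≤ β) (hκ : 0 ≤ κ)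
    (h0 : (1 + β • G.adjMatrix ℝ - Matrix.of fun _ _ => κ).PosSemidef)
    (h1 : ((s - 1) • (1 : Matrix V V ℝ) - β • G.adjMatrix ℝ).PosSemidef)
    (hd : 0 ≤ d) {n r : ℕ} {φ : ℕ → ℝ} (hφ : ∀ k, 0 ≤ φ k) (hφr : ∀ k, r < k → φ k = 0)
    {k₀ : ℕ} (hk₀ : k₀ ≤ n) (hφk₀ : 0 < φ k₀)
    (hT : ∀ k ≤ n, lam * φ k ≤ krawOp s n φ k) (hlam : (s - 1) * n - s * d < lam)
    {S : Finset (Fin n → V)} (hS : (CycleCodes.powGraph G n d).IsIndepSet S) :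
    κ ^ n * #S * (lam - ((s - 1) * n - s * d)) ≤
      s * d * ∑ a : Finset (Fin n) with #a ≤ r, (s - 1) ^ #a := by
  have hs1 : 0 < s - 1 := by linarith
  set lam' := (s - 1) * n - s * d with hlam'
  set u : ℕ → ℝ := fun k => krawOp s n φ k - lam' * φ k with hu
  have hcard : ∀ a : Finset (Fin n), #a ≤ n := fun a => by simpa using card_le_univ a
  have hu1 : ∀ a : Finset (Fin n), (lam - lam') * φ #a ≤ u #a := fun a => by
    have := hT _ (hcard a)
    simp only [hu]
    linarith
  have hu0 : ∀ a : Finset (Fin n), 0 ≤ u #a := fun a =>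
    le_trans (mul_nonneg (by linarith) (hφ _)) (hu1 a)
  set H : (Fin n → V) → (Fin n → V) → ℝ :=
    fun x y => ∑ a : Finset (Fin n), φ #a * ∏ j ∈ a, coordChar s (x j) (y j) with hH
  set W : (Fin n → V) → (Fin n → V) → ℝ :=
    fun x y => ∏ j, (1 + β • G.adjMatrix ℝ) (x j) (y j) with hW
  have hW0 : ∀ x y, 0 ≤ W x y := fun x y => prod_nonneg fun j _ => by
    simp only [Matrix.add_apply, Matrix.one_apply, Matrix.smul_apply, SimpleGraph.adjMatrix_apply,
      smul_eq_mul]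
    split_ifs <;> simp [hβ]
    linarith
  set Q : ℝ := ∑ a : Finset (Fin n), φ #a ^ 2 * (s - 1) ^ #a with hQ
  set vol : ℝ := ∑ a : Finset (Fin n) with #a ≤ r, (s - 1) ^ #a with hvol
  set H0 : ℝ := ∑ a : Finset (Fin n), φ #a * (s - 1) ^ #a with hH0
  have hvol0 : 0 ≤ vol := sum_nonneg fun a _ => by positivity
  have hQ0 : 0 < Q := by
    obtain ⟨a, -, ha⟩ := exists_subset_card_eq (s := (univ : Finset (Fin n))) (by simpa using hk₀)
    refine sum_pos' (fun a _ => by positivity) ⟨a, mem_univ _, ?_⟩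
    rw [ha]
    positivity
  -- Cauchy-Schwarz on the ball that carries `φ`
  have hCS : H0 ^ 2 ≤ vol * Q := by
    have e1 : H0 = ∑ a : Finset (Fin n) with #a ≤ r, φ #a * (s - 1) ^ #a := by
      rw [sum_filter_of_ne]
      intro a _ h
      by_contra hc
      exact h (by rw [hφr _ (not_le.1 hc), zero_mul])
    have e2 : ∑ a : Finset (Fin n) with #a ≤ r, φ #a ^ 2 * (s - 1) ^ #a ≤ Q :=
      sum_le_sum_of_subset_of_nonneg (filter_subset _ _) fun a _ _ => by positivity
    rw [e1]
    refine le_trans (sum_sq_le_sum_mul_sum_of_sq_le_mul _ (f := fun a => (s - 1) ^ #a)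
      (g := fun a => φ #a ^ 2 * (s - 1) ^ #a) (fun a _ => by positivity)
      (fun a _ => by positivity) fun a _ => le_of_eq (by ring)) ?_
    exact mul_le_mul_of_nonneg_left e2 hvol0
  set E : ℝ := ∑ x ∈ S, ∑ y ∈ S, W x y *
    ((∑ j, coordChar s (x j) (y j) - lam') * H x y ^ 2) with hE
  have hupper : E ≤ #S * (s * d * H0 ^ 2) := by
    rw [← nsmul_eq_mul, ← sum_const]
    refine sum_le_sum fun x hx => ?_
    rw [← add_sum_erase _ _ hx]
    have e1 : W x x = 1 := by simp [hW]
    have e2 : H x x = H0 := by simp [hH, hH0, coordChar]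
    have e3 : ∑ j, coordChar s (x j) (x j) - lam' = s * d := by
      rw [sum_coordChar, hlam']
      simp
    rw [e1, e2, e3, one_mul, add_le_iff_nonpos_right]
    refine sum_nonpos fun y hy => ?_
    obtain ⟨hyx, hy⟩ := mem_erase.1 hy
    by_cases hWxy : W x y = 0
    · simp [hWxy]
    · refine mul_nonpos_of_nonneg_of_nonpos (hW0 x y)
        (mul_nonpos_of_nonpos_of_nonneg ?_ (sq_nonneg _))
      have hna := hS (mem_coe.2 hx) (mem_coe.2 hy) (Ne.symm hyx)
      have hdist : ENNReal.ofReal d < CycleCodes.wdist G x y := by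
        by_contra hc
        exact hna ⟨Ne.symm hyx, not_lt.1 hc⟩
      rw [wdist_eq_of_prod_ne_zero G hWxy, ENNReal.ofReal_lt_iff_lt_toReal hd (ENNReal.natCast_ne_top _),
        ENNReal.toReal_natCast] at hdist
      rw [sum_coordChar, hlam']
      nlinarith
  have hlower : (lam - lam') * κ ^ n * (#S : ℝ) ^ 2 * Q ≤ E := by
    have hexp : E = ∑ a : Finset (Fin n), ∑ a' : Finset (Fin n), u #a * φ #a' *
        ∑ x ∈ S, ∑ y ∈ S, W x y * (∏ j ∈ a, coordChar s (x j) (y j)) *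
          ∏ j ∈ a', coordChar s (x j) (y j) := by
      have h2 : ∀ x y, W x y * ((∑ j, coordChar s (x j) (y j) - lam') * H x y ^ 2) =
          ∑ a : Finset (Fin n), ∑ a' : Finset (Fin n), u #a * φ #a' *
            (W x y * (∏ j ∈ a, coordChar s (x j) (y j)) *
              ∏ j ∈ a', coordChar s (x j) (y j)) := by
        intro x y
        have h3 : (∑ j, coordChar s (x j) (y j) - lam') * H x y =
            ∑ a : Finset (Fin n), u #a * ∏ j ∈ a, coordChar s (x j) (y j) := by
          rw [sub_mul, hH, sum_mul_sum_character (s := s) _ (fun j => coordChar_sq s _ _), mul_sum,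
            ← sum_sub_distrib]
          refine sum_congr rfl fun a _ => ?_
          simp only [hu]
          ring
        rw [sq, ← mul_assoc (_ - _), h3, hH, sum_mul_sum, mul_sum]
        refine sum_congr rfl fun a _ => ?_
        rw [mul_sum]
        refine sum_congr rfl fun a' _ => ?_
        ring
      rw [hE, sum_congr rfl fun x _ => sum_congr rfl fun y _ => h2 x y]
      simp only [mul_sum]
      rw [sum_congr rfl fun x _ => sum_comm, sum_comm]
      refine sum_congr rfl fun a _ => ?_
      rw [sum_congr rfl fun x _ => sum_comm, sum_comm]
    rw [hexp, hQ, mul_sum]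
    refine sum_le_sum fun a _ => ?_
    have hterm : ∀ a', (if a = a' then u #a * φ #a' * (κ ^ n * (s - 1) ^ #a * (#S : ℝ) ^ 2) else 0)
        ≤ u #a * φ #a' * ∑ x ∈ S, ∑ y ∈ S, W x y * (∏ j ∈ a, coordChar s (x j) (y j)) *
          ∏ j ∈ a', coordChar s (x j) (y j) := by
      intro a'
      have := mul_le_mul_of_nonneg_left (sum_twisted_lower_bound G hs hκ h0 h1 S a a')
        (mul_nonneg (hu0 a) (hφ #a'))
      rwa [mul_ite, mul_zero] at this
    refine le_trans ?_ (sum_le_sum fun a' _ => hterm a')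
    rw [sum_ite_eq, if_pos (mem_univ _)]
    have h4 := mul_le_mul_of_nonneg_right (hu1 a)
      (show 0 ≤ φ #a * (κ ^ n * (s - 1) ^ #a * (#S : ℝ) ^ 2) by
        have := hφ #a
        positivity)
    calc _ = _ := by ring
      _ ≤ _ := h4
      _ = _ := by ring
  rcases Nat.eq_zero_or_pos #S with h5 | h5
  · rw [h5]
    simp only [Nat.cast_zero, mul_zero, zero_mul]
    positivity
  · have h6 : (0 : ℝ) < #S := by exact_mod_cast h5
    have h7 : #S * (s * d * H0 ^ 2) ≤ #S * (s * d * (vol * Q)) := by gcongr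
    refine le_of_mul_le_mul_right ?_ (mul_pos h6 hQ0)
    calc _ = (lam - lam') * κ ^ n * (#S : ℝ) ^ 2 * Q := by ring
      _ ≤ #S * (s * d * (vol * Q)) := (hlower.trans hupper).trans h7
      _ = _ := by ring

end Kernel

/-! ### Spectral estimates for odd cycles -/

theorem fin_val_sub_eq_one_iff_dvd {q : ℕ} (hq : 2 ≤ q) (v w : Fin q) :
    (v - w).val = 1 ↔ (q : ℤ) ∣ (v : ℤ) - w - 1 := by
  have hv := v.isLt
  have hw := w.isLt
  have hval : ((v - w).val = v.val - w.val ∧ w.val ≤ v.val) ∨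
      ((v - w).val = q + v.val - w.val ∧ v.val < w.val) := by
    rcases le_or_gt w v with h | h
    · exact Or.inl ⟨Fin.sub_val_of_le h, h⟩
    · exact Or.inr ⟨Fin.coe_sub_iff_lt.2 h, h⟩
  constructor
  · intro h
    rcases hval with ⟨h1, h2⟩ | ⟨h1, h2⟩
    · exact ⟨0, by omega⟩
    · exact ⟨-1, by omega⟩
  · rintro ⟨k, hk⟩
    have hk1 : k < 1 := by
      by_contra hc
      nlinarith
    have hk2 : -2 < k := by
      by_contra hc
      nlinarith
    obtain rfl | rfl : k = 0 ∨ k = -1 := by omega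
    · omega
    · omega

theorem cycleGraph_adj_iff_dvd {q : ℕ} (hq : 2 ≤ q) (v w : Fin q) :
    (SimpleGraph.cycleGraph q).Adj v w ↔
      (q : ℤ) ∣ (v : ℤ) - w - 1 ∨ (q : ℤ) ∣ (v : ℤ) - w + 1 := by
  rw [SimpleGraph.cycleGraph_adj', fin_val_sub_eq_one_iff_dvd hq, fin_val_sub_eq_one_iff_dvd hq,
    ← dvd_neg (b := (w : ℤ) - v - 1)]
  ring_nf

theorem sum_exp_two_pi_mul {q : ℕ} (hq : 0 < q) (d : ℤ) :
    ∑ k : Fin q, Complex.exp ((2 * π * k * d / q : ℝ) * Complex.I) =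
      if (q : ℤ) ∣ d then (q : ℂ) else 0 := by
  have hζ := Complex.isPrimitiveRoot_exp q hq.ne'
  set ζ := Complex.exp (2 * π * Complex.I / q) with hζd
  have e : ∀ k : Fin q, Complex.exp ((2 * π * k * d / q : ℝ) * Complex.I) = (ζ ^ d) ^ (k : ℕ) := by
    intro k
    rw [hζd, ← Complex.exp_int_mul, ← Complex.exp_nat_mul]
    congr 1
    push_cast
    ring
  rw [sum_congr rfl fun k _ => e k, Fin.sum_univ_eq_sum_range (fun k => (ζ ^ d) ^ k) q]
  split_ifs with h
  · rw [(hζ.zpow_eq_one_iff_dvd d).2 h]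
    simp
  · rw [geom_sum_eq (fun h' => h ((hζ.zpow_eq_one_iff_dvd d).1 h'))]
    rw [← zpow_natCast, ← zpow_mul, mul_comm, zpow_mul, zpow_natCast, hζ.pow_eq_one, one_zpow,
      sub_self, zero_div]

theorem sum_cos_two_pi_mul {q : ℕ} (hq : 0 < q) (d : ℤ) :
    ∑ k : Fin q, cos (2 * π * k * d / q) = if (q : ℤ) ∣ d then (q : ℝ) else 0 := by
  have h := congrArg Complex.re (sum_exp_two_pi_mul hq d)
  rw [Complex.re_sum, sum_congr rfl fun k _ => Complex.exp_ofReal_mul_I_re _] at h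
  rw [h]
  split_ifs <;> simp

theorem sum_sin_two_pi_mul {q : ℕ} (hq : 0 < q) (d : ℤ) :
    ∑ k : Fin q, sin (2 * π * k * d / q) = 0 := by
  have h := congrArg Complex.im (sum_exp_two_pi_mul hq d)
  rw [Complex.im_sum, sum_congr rfl fun k _ => Complex.exp_ofReal_mul_I_im _] at h
  rw [h]
  split_ifs <;> simp

/-- Spectral decomposition of `p I + r A`, where `A` is the adjacency matrix of a cycle. -/
theorem cycle_entry_eq_sum {q : ℕ} (hq : 3 ≤ q) (p r : ℝ) (v w : Fin q) :
    (p • (1 : Matrix (Fin q) (Fin q) ℝ) + r • (SimpleGraph.cycleGraph q).adjMatrix ℝ) v w =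
      ∑ k : Fin q, (p + 2 * r * cos (2 * π * k / q)) / q *
        (cos (2 * π * k * v / q) * cos (2 * π * k * w / q) +
          sin (2 * π * k * v / q) * sin (2 * π * k * w / q)) := by
  have hq0 : 0 < q := by omega
  have hq' : (q : ℝ) ≠ 0 := by positivity
  have e : ∀ k : Fin q, (p + 2 * r * cos (2 * π * k / q)) / q *
        (cos (2 * π * k * v / q) * cos (2 * π * k * w / q) +
          sin (2 * π * k * v / q) * sin (2 * π * k * w / q)) =
      p / q * cos (2 * π * k * ((v : ℤ) - w : ℤ) / q) +
      (r / q * cos (2 * π * k * ((v : ℤ) - w + 1 : ℤ) / q) +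
      r / q * cos (2 * π * k * ((v : ℤ) - w - 1 : ℤ) / q)) := by
    intro k
    have e1 : 2 * π * k * ((v : ℤ) - w + 1 : ℤ) / q =
        (2 * π * k * v / q - 2 * π * k * w / q) + 2 * π * k / q := by
      push_cast
      ring
    have e2 : 2 * π * k * ((v : ℤ) - w - 1 : ℤ) / q =
        (2 * π * k * v / q - 2 * π * k * w / q) - 2 * π * k / q := by
      push_cast
      ring
    have e3 : 2 * π * k * ((v : ℤ) - w : ℤ) / q =
        2 * π * k * v / q - 2 * π * k * w / q := by
      push_cast
      ring
    rw [← cos_sub, e1, e2, e3, cos_add, cos_sub (2 * π * k * v / q - 2 * π * k * w / q)]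
    ring
  rw [sum_congr rfl fun k _ => e k, sum_add_distrib, sum_add_distrib, ← mul_sum, ← mul_sum,
    ← mul_sum, sum_cos_two_pi_mul hq0, sum_cos_two_pi_mul hq0, sum_cos_two_pi_mul hq0]
  have hv := v.isLt
  have hw := w.isLt
  have h1 : (q : ℤ) ∣ (v : ℤ) - w ↔ v = w := by
    constructor
    · intro h
      have := Int.eq_zero_of_abs_lt_dvd h (by rw [abs_lt]; omega)
      exact Fin.ext (by omega)
    · rintro rfl
      simp
  have h2 : ¬ ((q : ℤ) ∣ (v : ℤ) - w + 1 ∧ (q : ℤ) ∣ (v : ℤ) - w - 1) := by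
    rintro ⟨h, h'⟩
    have := Int.le_of_dvd (by norm_num) ((dvd_sub h h').trans (by ring_nf; rfl : _ ∣ (2 : ℤ)))
    omega
  have hA : (SimpleGraph.cycleGraph q).adjMatrix ℝ v w =
      (if (q : ℤ) ∣ (v : ℤ) - w + 1 then 1 else 0) +
        if (q : ℤ) ∣ (v : ℤ) - w - 1 then 1 else 0 := by
    rw [SimpleGraph.adjMatrix_apply]
    simp only [cycleGraph_adj_iff_dvd (by omega : 2 ≤ q)]
    by_cases ha : (q : ℤ) ∣ (v : ℤ) - w + 1 <;> by_cases hb : (q : ℤ) ∣ (v : ℤ) - w - 1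
    · exact absurd ⟨ha, hb⟩ h2
    all_goals simp [ha, hb]
  simp only [Matrix.add_apply, Matrix.smul_apply, smul_eq_mul, hA, Matrix.one_apply, h1]
  have hite : ∀ (P : Prop) [Decidable P], (if P then (q : ℝ) else 0) = q * if P then 1 else 0 :=
    fun P _ => by simp
  simp only [hite]
  field_simp

/-- Off the constant vectors the eigenvalues of `p I + r A` are `p + 2 r cos (2 π k / q)` with `k ≠ 0`;
subtracting `κ J` changes only the eigenvalue of the constant vectors. -/
theorem cycle_posSemidef {q : ℕ} (hq : 3 ≤ q) {p r κ : ℝ} (h0 : κ * q ≤ p + 2 * r)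
    (h : ∀ k : Fin q, (k : ℕ) ≠ 0 → 0 ≤ p + 2 * r * cos (2 * π * k / q)) :
    (p • (1 : Matrix (Fin q) (Fin q) ℝ) + r • (SimpleGraph.cycleGraph q).adjMatrix ℝ -
      Matrix.of fun _ _ => κ).PosSemidef := by
  have hq' : (q : ℝ) ≠ 0 := by positivity
  have e : p • (1 : Matrix (Fin q) (Fin q) ℝ) + r • (SimpleGraph.cycleGraph q).adjMatrix ℝ -
      Matrix.of (fun _ _ => κ) = ∑ k : Fin q,
        ((p + 2 * r * cos (2 * π * k / q) - if (k : ℕ) = 0 then κ * q else 0) / q) •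
          (Matrix.vecMulVec (fun v : Fin q => cos (2 * π * k * v / q))
              (star fun v : Fin q => cos (2 * π * k * v / q)) +
            Matrix.vecMulVec (fun v : Fin q => sin (2 * π * k * v / q))
              (star fun v : Fin q => sin (2 * π * k * v / q))) := by
    ext v w
    rw [Matrix.sub_apply, cycle_entry_eq_sum hq, Matrix.sum_apply]
    simp only [Matrix.smul_apply, Matrix.add_apply, Matrix.vecMulVec_apply,
      star_trivial, smul_eq_mul, sub_div, sub_mul, sum_sub_distrib, Matrix.of_apply]
    congr 1
    rw [sum_eq_single (⟨0, by omega⟩ : Fin q)]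
    · simp
      field_simp
    · intro k _ hk
      rw [if_neg fun h => hk (Fin.ext h)]
      simp
    · simp
  rw [e]
  refine Matrix.posSemidef_sum _ fun k _ => Matrix.PosSemidef.smul
    ((Matrix.posSemidef_vecMulVec_self_star _).add (Matrix.posSemidef_vecMulVec_self_star _)) ?_
  refine div_nonneg ?_ (by positivity)
  split_ifs with hk
  · simp [hk]
    linarith
  · simpa using h k hk

/-- The least eigenvalue of an odd cycle is `-2 cos (π / q)`. -/
theorem neg_cos_le_cos_two_pi_mul_div {q : ℕ} (hq : Odd q) {k : ℕ} (hk : k ≤ q) :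
    -cos (π / q) ≤ cos (2 * π * k / q) := by
  have hq0 : (0 : ℝ) < q := by exact_mod_cast hq.pos
  have hodd : 1 ≤ |(2 * k - q : ℤ)| := by
    obtain ⟨m, rfl⟩ := hq
    exact Int.one_le_abs (by omega)
  have hle : |(2 * k - q : ℤ)| ≤ q := by
    rw [abs_le]
    omega
  have hodd' : (1 : ℝ) ≤ |(2 * k - q : ℝ)| := by exact_mod_cast hodd
  have hle' : |(2 * k - q : ℝ)| ≤ q := by exact_mod_cast hle
  have e : cos (2 * π * k / q) = -cos (π * |(2 * k - q : ℝ)| / q) := by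
    have h1 : π * |(2 * k - q : ℝ)| / q = |2 * π * k / q - π| := by
      rw [show 2 * π * k / q - π = π * (2 * k - q) / q by field_simp, abs_div, abs_mul,
        abs_of_pos pi_pos, abs_of_pos hq0]
    rw [h1, cos_abs, cos_sub_pi, neg_neg]
  rw [e, neg_le_neg_iff]
  refine cos_le_cos_of_nonneg_of_le_pi (by positivity) ?_ ?_
  · rw [div_le_iff₀ hq0]
    gcongr
  · gcongr
    nlinarith [pi_pos]

theorem one_half_le_cos_pi_div {q : ℕ} (hq : 3 ≤ q) : 1 / 2 ≤ cos (π / q) := by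
  rw [← cos_pi_div_three]
  have h3 : (3 : ℝ) ≤ q := by exact_mod_cast hq
  refine cos_le_cos_of_nonneg_of_le_pi (by positivity) ?_ (by gcongr)
  linarith [pi_pos]

theorem two_lt_qprime {q : ℕ} (hq : 3 ≤ q) : 2 < CycleCodes.qprime q := by
  have h := one_half_le_cos_pi_div hq
  have h1 : cos (π / q) < 1 := by
    rw [← cos_zero]
    have h3 : (3 : ℝ) ≤ q := by exact_mod_cast hq
    refine cos_lt_cos_of_nonneg_of_le_pi le_rfl ?_ (by positivity)
    rw [div_le_iff₀ (by linarith)]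
    nlinarith [pi_pos]
  have h2 : 1 < 1 / cos (π / q) := by
    rw [lt_div_iff₀ (by linarith)]
    linarith
  unfold CycleCodes.qprime
  linarith

theorem qprime_sub_one {q : ℕ} : CycleCodes.qprime q - 1 = 1 / cos (π / q) := by
  unfold CycleCodes.qprime
  ring

/-- The kernel `D / θ` for the optimal solution `D` of the program that defines the theta function
of an odd cycle. -/
theorem cycle_theta_kernel_posSemidef {q : ℕ} (hodd : Odd q) (hq : 3 ≤ q) :
    (1 + ((CycleCodes.qprime q - 1) / 2) • (SimpleGraph.cycleGraph q).adjMatrix ℝ -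
      Matrix.of fun _ _ => CycleCodes.qprime q / q).PosSemidef := by
  have hc := one_half_le_cos_pi_div hq
  have h := cycle_posSemidef hq (p := 1) (r := (CycleCodes.qprime q - 1) / 2)
    (κ := CycleCodes.qprime q / q) (by field_simp; linarith) (fun k _ => by
      have h1 := neg_cos_le_cos_two_pi_mul_div hodd k.isLt.le
      rw [qprime_sub_one]
      field_simp
      linarith)
  rwa [one_smul] at h

theorem cycle_complementary_kernel_posSemidef {q : ℕ} (hq : 3 ≤ q) :
    ((CycleCodes.qprime q - 1) • (1 : Matrix (Fin q) (Fin q) ℝ) -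
      ((CycleCodes.qprime q - 1) / 2) • (SimpleGraph.cycleGraph q).adjMatrix ℝ).PosSemidef := by
  have hs := two_lt_qprime hq
  have h := cycle_posSemidef hq (p := CycleCodes.qprime q - 1)
    (r := -((CycleCodes.qprime q - 1) / 2)) (κ := 0) (by linarith) (fun k _ => by
      nlinarith [cos_le_one (2 * π * k / q)])
  convert h using 1
  ext v w
  simp
  ring

/-- Weak duality for the theta function of an odd cycle: the dual matrix
`c + cos (π (q - 1) (v - w) / q)`, with `c = cos (π / q)`, vanishes on the edges. -/
theorem div_qprime_le_thetaL {q : ℕ} (hodd : Odd q) (hq : 3 ≤ q) :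
    q / CycleCodes.qprime q ≤ CycleCodes.thetaL (SimpleGraph.cycleGraph q) := by
  have hq0 : 0 < q := by omega
  have hq0' : (0 : ℝ) < q := by exact_mod_cast hq0
  set c := cos (π / q) with hc
  have hc0 : 1 / 2 ≤ c := one_half_le_cos_pi_div hq
  refine le_csInf ?_ ?_
  · refine ⟨_, (q : ℝ) • (1 : Matrix (Fin q) (Fin q) ℝ), ?_, ?_, rfl⟩
    · have h := cycle_posSemidef hq (p := q) (r := 0) (κ := 1) (by simp) (fun k _ => by simp)
      simpa using h
    · intro v w h
      simp [h.ne]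
  · rintro t ⟨D, hD, hD0, rfl⟩
    -- with `q = 2 m + 1`, the cosine in the dual matrix is that of the `m`-th character
    obtain ⟨m, hm⟩ := hodd
    have hndvd : ¬ (q : ℤ) ∣ m := by
      intro h
      have := Int.le_of_dvd (by omega) h
      omega
    have hm' : (q : ℝ) = 2 * m + 1 := by exact_mod_cast hm
    have hsum1 := sum_cos_two_pi_mul hq0 m
    have hsum2 := sum_sin_two_pi_mul hq0 m
    rw [if_neg hndvd] at hsum1
    set C : Fin q → ℝ := fun v => cos (2 * π * v * (m : ℤ) / q)
    set T : Fin q → ℝ := fun v => sin (2 * π * v * (m : ℤ) / q)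
    have key : ∀ v w : Fin q, D v w * (c + (C v * C w + T v * T w)) =
        if v = w then D v v * (c + 1) else 0 := by
      intro v w
      by_cases hvw : v = w
      · subst hvw
        rw [if_pos rfl, ← sq, ← sq, cos_sq_add_sin_sq]
      · rw [if_neg hvw]
        by_cases hadj : (SimpleGraph.cycleGraph q).Adj v w
        · suffices h : C v * C w + T v * T w = -c by rw [h]; ring
          rw [← cos_sub, hc, ← cos_sub_pi]
          rcases (cycleGraph_adj_iff_dvd (by omega) v w).1 hadj with ⟨k, hk⟩ | ⟨k, hk⟩
          · have hk' : (v : ℝ) = w + 1 + q * k := by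
              have : (v : ℤ) = w + 1 + q * k := by linarith
              exact_mod_cast this
            rw [← cos_neg (π / q - π), ← cos_add_int_mul_two_pi (-(π / q - π)) (m * k)]
            congr 1
            rw [hk']
            push_cast
            field_simp
            rw [hm']
            ring
          · have hk' : (v : ℝ) = w - 1 + q * k := by
              have : (v : ℤ) = w - 1 + q * k := by linarith
              exact_mod_cast this
            rw [← cos_add_int_mul_two_pi (π / q - π) (m * k)]
            congr 1
            rw [hk']
            push_cast
            field_simp
            rw [hm']
            ring
        · rw [hD0 v w ((SimpleGraph.compl_adj _ _ _).2 ⟨hvw, hadj⟩), zero_mul]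
    have quad : ∀ u : Fin q → ℝ, (∑ v, u v) ^ 2 ≤ ∑ v, ∑ w, D v w * (u v * u w) := by
      intro u
      have h := posSemidef_sum_nonneg hD u
      have e : ∑ v, ∑ w, u v * (D - Matrix.of fun _ _ => (1 : ℝ) : Matrix _ _ ℝ) v w * u w =
          ∑ v, ∑ w, D v w * (u v * u w) - (∑ v, u v) ^ 2 := by
        rw [sq, sum_mul_sum, ← sum_sub_distrib]
        refine sum_congr rfl fun v _ => ?_
        rw [← sum_sub_distrib]
        refine sum_congr rfl fun w _ => ?_
        simp only [Matrix.sub_apply, Matrix.of_apply]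
        ring
      linarith
    have q1 := quad fun _ => 1
    have q2 := quad C
    have q3 := quad T
    have hsum : ∑ v, ∑ w, D v w * (c + (C v * C w + T v * T w)) = (c + 1) * ∑ v, D v v := by
      simp only [key]
      simp [mul_sum, mul_comm]
    have hsplit : ∑ v, ∑ w, D v w * (c + (C v * C w + T v * T w)) =
        c * ∑ v, ∑ w, D v w * (1 * 1) + (∑ v, ∑ w, D v w * (C v * C w) +
          ∑ v, ∑ w, D v w * (T v * T w)) := by
      simp only [mul_sum, ← sum_add_distrib]
      refine sum_congr rfl fun v _ => sum_congr rfl fun w _ => ?_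
      ring
    have htr : ∑ v, D v v ≤ q * ⨆ v, D v v := by
      have := sum_le_card_nsmul univ (fun v => D v v) (⨆ v, D v v)
        fun v _ => le_ciSup (Set.finite_range fun v => D v v).bddAbove v
      simpa using this
    have hfin : c * q ^ 2 ≤ (c + 1) * (q * ⨆ v, D v v) := by
      have h1 : (c + 1) * ∑ v, D v v ≤ (c + 1) * (q * ⨆ v, D v v) := by gcongr
      have h2 : c * (∑ _v : Fin q, (1 : ℝ)) ^ 2 ≤ c * ∑ v, ∑ w, D v w * (1 * 1) := by gcongr
      simp only [sum_const, card_univ, Fintype.card_fin, nsmul_eq_mul, mul_one] at h2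
      simp only [mul_one] at hsplit
      nlinarith [sq_nonneg (∑ v, C v), sq_nonneg (∑ v, T v)]
    have hs : CycleCodes.qprime q = (c + 1) / c := by
      unfold CycleCodes.qprime
      rw [← hc]
      field_simp
    rw [hs, div_div_eq_mul_div, div_le_iff₀ (by linarith)]
    nlinarith

/-! ### An approximate eigenfunction of the Krawtchouk operator -/

/-- A sine arch on the window `r - m < k ≤ r`, scaled by `μ ^ (-k)`. -/
noncomputable def sineArch (m r : ℕ) (μ : ℝ) (k : ℕ) : ℝ :=
  if r < k + m ∧ k ≤ r then sin (π * ((k : ℝ) + m - r) / (m + 1)) / μ ^ k else 0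

/-- The sine vanishes at both ends of the window, so that its formula extends by one step. -/
theorem sineArch_eq {m r : ℕ} (μ : ℝ) {k : ℕ} (h1 : r ≤ k + m) (h2 : k ≤ r + 1) :
    sineArch m r μ k = sin (π * ((k : ℝ) + m - r) / (m + 1)) / μ ^ k := by
  unfold sineArch
  split_ifs with h
  · rfl
  · rcases (by omega : r = k + m ∨ k = r + 1) with h | h
    · rw [h]
      simp
    · rw [h]
      have : π * (((r + 1 : ℕ) : ℝ) + m - r) / (m + 1) = π := by
        push_cast
        field_simp
        ring
      rw [this]
      simp

theorem sineArch_pos {m r : ℕ} {μ : ℝ} (hμ : 0 < μ) {k : ℕ} (h1 : r < k + m) (h2 : k ≤ r) :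
    0 < sineArch m r μ k := by
  rw [sineArch_eq μ h1.le (by omega)]
  have h1' : (r : ℝ) < k + m := by exact_mod_cast h1
  have h2' : (k : ℝ) ≤ r := by exact_mod_cast h2
  refine div_pos (sin_pos_of_pos_of_lt_pi ?_ ?_) (by positivity)
  · have : 0 < (k : ℝ) + m - r := by linarith
    positivity
  · rw [div_lt_iff₀ (by positivity)]
    nlinarith [pi_pos]

theorem sineArch_nonneg {m r : ℕ} {μ : ℝ} (hμ : 0 < μ) (k : ℕ) : 0 ≤ sineArch m r μ k := by
  by_cases h : r < k + m ∧ k ≤ r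
  · exact (sineArch_pos hμ h.1 h.2).le
  · simp [sineArch, h]

theorem sineArch_eq_zero {m r : ℕ} {μ : ℝ} {k : ℕ} (h : r < k) : sineArch m r μ k = 0 := by
  simp [sineArch, h]

/-- The scaled form of `sin (x + y) + sin (x - y) = 2 cos y sin x`. -/
theorem sineArch_add {m r : ℕ} {μ : ℝ} (hμ : 0 < μ) {k : ℕ} (h1 : r < k + 1 + m)
    (h2 : k + 1 ≤ r) :
    μ * sineArch m r μ (k + 2) + sineArch m r μ k / μ =
      2 * cos (π / (m + 1)) * sineArch m r μ (k + 1) := by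
  rw [sineArch_eq μ (by omega) (by omega), sineArch_eq μ (by omega) (by omega),
    sineArch_eq μ (by omega) (by omega)]
  have e1 : π * (((k + 2 : ℕ) : ℝ) + m - r) / (m + 1) =
      π * (((k + 1 : ℕ) : ℝ) + m - r) / (m + 1) + π / (m + 1) := by
    push_cast
    ring
  have e2 : π * ((k : ℝ) + m - r) / (m + 1) =
      π * (((k + 1 : ℕ) : ℝ) + m - r) / (m + 1) - π / (m + 1) := by
    push_cast
    ring
  rw [e1, e2, sin_add, sin_sub]
  field_simp
  ring

/-- On the window, the coefficients of the Krawtchouk operator are nearly constant, and the sine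
arch is an eigenfunction of the operator with these constant coefficients; the last term of the
eigenvalue accounts for the variation of the coefficients. -/
theorem mul_sineArch_le_krawOp {s ρ : ℝ} (hs : 2 ≤ s) (hρ : 0 < ρ) (hρ1 : ρ < 1) {n m r : ℕ}
    (hr : (r : ℝ) ≤ ρ * n) (hr' : ρ * n < r + 1) (hmr : m ≤ r) {k : ℕ} (hk : k ≤ n) :
    (n * (2 * √((s - 1) * ρ * (1 - ρ)) * cos (π / (m + 1)) + ρ * (s - 2)) -
      m * (2 * √((s - 1) * (1 - ρ) / ρ) + (s - 2))) *
        sineArch m r √((s - 1) * (1 - ρ) / ρ) k ≤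
      krawOp s n (sineArch m r √((s - 1) * (1 - ρ) / ρ)) k := by
  have hs1 : 0 < s - 1 := by linarith
  have hs2 : 0 ≤ s - 2 := by linarith
  have hρ' : 0 < 1 - ρ := by linarith
  set μ := √((s - 1) * (1 - ρ) / ρ) with hμ
  have hμ0 : 0 < μ := sqrt_pos.2 (by positivity)
  have hμ2 : μ ^ 2 * ρ = (s - 1) * (1 - ρ) := by
    rw [hμ, sq_sqrt (by positivity)]
    field_simp
  have hw : √((s - 1) * ρ * (1 - ρ)) = ρ * μ := by
    rw [sqrt_eq_iff_mul_self_eq (by positivity) (by positivity)]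
    linear_combination (-ρ) * hμ2
  rw [hw]
  have hkn : (k : ℝ) ≤ n := by exact_mod_cast hk
  have hφ := sineArch_nonneg (m := m) (r := r) hμ0
  by_cases h : r < k + m ∧ k ≤ r
  · obtain ⟨h1, h2⟩ := h
    obtain ⟨k, rfl⟩ : ∃ j, k = j + 1 := ⟨k - 1, by omega⟩
    have hadd := sineArch_add hμ0 h1 h2
    have hc1 : cos (π / (m + 1)) ≤ 1 := cos_le_one _
    set c := cos (π / (m + 1))
    have f0 := hφ k
    have f1 := hφ (k + 1)
    have f2 := hφ (k + 2)
    rw [krawOp, Nat.add_sub_cancel]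
    set A := sineArch m r μ k
    set B := sineArch m r μ (k + 1)
    set D := sineArch m r μ (k + 2)
    have h1' : (r : ℝ) + 1 ≤ (k + 1 : ℕ) + m := by exact_mod_cast h1
    have h2' : ((k + 1 : ℕ) : ℝ) ≤ r := by exact_mod_cast h2
    set x : ℝ := ((k + 1 : ℕ) : ℝ)
    -- the four estimates replace the coefficients at `x` by those at `ρ * n`
    have hA : A / μ ≤ 2 * B := by
      have : 0 ≤ μ * D := by positivity
      nlinarith
    have g1 : n * ρ * μ * (μ * D) ≤ (n - x) * (s - 1) * D := by
      have : n * ((s - 1) * (1 - ρ)) ≤ (n - x) * (s - 1) := by nlinarith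
      rw [← hμ2] at this
      nlinarith
    have g2 : (ρ * n - m) * (μ * (A / μ)) ≤ x * A := by
      rw [mul_div_cancel₀ _ hμ0.ne']
      gcongr
      linarith
    have g3 : (ρ * n - m) * (s - 2) * B ≤ x * (s - 2) * B := by
      gcongr
      linarith
    have g4 : m * μ * (A / μ) ≤ m * μ * (2 * B) := by gcongr
    linear_combination g1 + g2 + g3 + g4 - n * ρ * μ * hadd
  · rw [show sineArch m r μ k = 0 by simp [sineArch, h], mul_zero, krawOp]
    have := hφ (k + 1)
    have := hφ (k - 1)
    have := hφ k
    have : 0 ≤ (n : ℝ) - k := by linarith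
    positivity

/-! ### The volume of a ball -/

/-- The volume bound by the entropy: compare with the binomial expansion of `(ρ + (1 - ρ)) ^ n`. -/
theorem sum_pow_card_le_exp {s ρ : ℝ} (hs : 1 < s) (hρ : 0 < ρ) (hρs : ρ ≤ 1 - 1 / s) {n r : ℕ}
    (hr : (r : ℝ) ≤ ρ * n) :
    ∑ a : Finset (Fin n) with #a ≤ r, (s - 1) ^ #a ≤ exp (n * CycleCodes.Hq s ρ) := by
  have hs1 : 0 < s - 1 := by linarith
  have hs0 : 0 < s := by linarith
  have hρ1 : 0 < 1 - ρ := by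
    have : 0 < 1 / s := by positivity
    linarith
  have hx1 : ρ / ((s - 1) * (1 - ρ)) ≤ 1 := by
    rw [div_le_one (by positivity)]
    rw [← sub_nonneg] at hρs
    have := mul_nonneg hs0.le hρs
    field_simp at this
    linarith
  have hlogx : log (ρ / ((s - 1) * (1 - ρ))) = log ρ - log (s - 1) - log (1 - ρ) := by
    rw [log_div (by positivity) (by positivity), log_mul (by positivity) (by positivity)]
    ring
  have hlog0 : log (ρ / ((s - 1) * (1 - ρ))) ≤ 0 := log_nonpos (by positivity) hx1
  have hterm : ∀ a : Finset (Fin n), #a ≤ r →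
      (s - 1) ^ #a * exp (-(n * CycleCodes.Hq s ρ)) ≤ ρ ^ #a * (1 - ρ) ^ (n - #a) := by
    intro a ha
    have han : #a ≤ n := by simpa using card_le_univ a
    have ha' : (#a : ℝ) ≤ ρ * n := le_trans (by exact_mod_cast ha) hr
    rw [← log_le_log_iff (by positivity) (by positivity), log_mul (by positivity) (by positivity),
      log_mul (by positivity) (by positivity), log_exp, log_pow, log_pow, log_pow,
      Nat.cast_sub han, CycleCodes.Hq]
    rw [hlogx] at hlog0
    nlinarith
  have hsum : ∑ a : Finset (Fin n) with #a ≤ r, (s - 1) ^ #a * exp (-(n * CycleCodes.Hq s ρ)) ≤ 1 :=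
    calc _ ≤ ∑ a : Finset (Fin n) with #a ≤ r, ρ ^ #a * (1 - ρ) ^ (n - #a) :=
          sum_le_sum fun a ha => hterm a (mem_filter.1 ha).2
      _ ≤ ∑ a : Finset (Fin n), ρ ^ #a * (1 - ρ) ^ (n - #a) :=
          sum_le_sum_of_subset_of_nonneg (filter_subset _ _) fun a _ _ => by positivity
      _ = 1 := by rw [Fin.sum_pow_mul_eq_add_pow]; simp
  rw [← sum_mul, exp_neg, ← div_eq_mul_inv, div_le_one (exp_pos _)] at hsum
  exact hsum

/-! ### The asymptotic bound -/

/-- The linear programming bound with the radius `ρ * n` of the ball left as a parameter. -/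
theorem exists_eventually_card_le {V : Type*} [Fintype V] [DecidableEq V] (G : SimpleGraph V)
    [DecidableRel G.Adj] {s β κ δ ρ : ℝ} (hs : 2 ≤ s) (hβ : 0 ≤ β) (hκ : 0 ≤ κ)
    (h0 : (1 + β • G.adjMatrix ℝ - Matrix.of fun _ _ => κ).PosSemidef)
    (h1 : ((s - 1) • (1 : Matrix V V ℝ) - β • G.adjMatrix ℝ).PosSemidef)
    (hδ : 0 < δ) (hρ : 0 < ρ) (hρs : ρ ≤ 1 - 1 / s)
    (hlt : (s - 1) - s * δ < 2 * √((s - 1) * ρ * (1 - ρ)) + ρ * (s - 2)) :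
    ∃ C > 0, ∀ᶠ n : ℕ in atTop, ∀ S : Finset (Fin n → V),
      (CycleCodes.powGraph G n (δ * n)).IsIndepSet S →
        κ ^ n * #S ≤ C * exp (n * CycleCodes.Hq s ρ) := by
  have hs0 : 0 < s := by linarith
  have hρ1 : ρ < 1 := by
    have : 0 < 1 / s := by positivity
    linarith
  -- a window length for which the loss `cos (π / (m + 1))` is harmless
  have hcos : Tendsto (fun m : ℕ => 2 * √((s - 1) * ρ * (1 - ρ)) * cos (π / (m + 1)) + ρ * (s - 2))
      atTop (𝓝 (2 * √((s - 1) * ρ * (1 - ρ)) + ρ * (s - 2))) := by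
    have h2 : Tendsto (fun m : ℕ => π / ((m : ℝ) + 1)) atTop (𝓝 0) :=
      tendsto_const_nhds.div_atTop (tendsto_atTop_add_const_right _ _ tendsto_natCast_atTop_atTop)
    have h3 := (continuous_cos.tendsto 0).comp h2
    rw [cos_zero] at h3
    simpa using (h3.const_mul (2 * √((s - 1) * ρ * (1 - ρ)))).add_const (ρ * (s - 2))
  obtain ⟨m, hm, hm1⟩ := ((hcos.eventually_const_lt hlt).and (eventually_ge_atTop 1)).exists
  set L := 2 * √((s - 1) * ρ * (1 - ρ)) * cos (π / (m + 1)) + ρ * (s - 2) with hL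
  set ε := (L - ((s - 1) - s * δ)) / 2 with hε
  have hε0 : 0 < ε := by
    rw [hε]
    linarith
  set μ := √((s - 1) * (1 - ρ) / ρ) with hμ
  have hμ0 : 0 < μ := sqrt_pos.2 (div_pos (mul_pos (by linarith) (by linarith)) hρ)
  refine ⟨s * δ / ε, by positivity, ?_⟩
  have e1 : ∀ᶠ n : ℕ in atTop, (m : ℝ) * (2 * μ + (s - 2)) ≤ ε * n :=
    (tendsto_natCast_atTop_atTop.const_mul_atTop hε0).eventually_ge_atTop _
  have e2 : ∀ᶠ n : ℕ in atTop, (m : ℝ) ≤ ρ * n :=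
    (tendsto_natCast_atTop_atTop.const_mul_atTop hρ).eventually_ge_atTop _
  filter_upwards [e1, e2, eventually_gt_atTop 0] with n hn1 hn2 hn0 S hS
  have hn0' : (0 : ℝ) < n := by exact_mod_cast hn0
  set r := ⌊ρ * n⌋₊
  have hr : (r : ℝ) ≤ ρ * n := Nat.floor_le (by positivity)
  have hr' : ρ * n < r + 1 := Nat.lt_floor_add_one _
  have hmr : m ≤ r := Nat.le_floor hn2
  have hrn : r ≤ n := by
    have : (r : ℝ) ≤ n := hr.trans (by nlinarith)
    exact_mod_cast this
  have hgap : ε * n ≤ n * L - m * (2 * μ + (s - 2)) - ((s - 1) * n - s * (δ * n)) := by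
    have : L = 2 * ε + ((s - 1) - s * δ) := by
      rw [hε]
      ring
    rw [this]
    nlinarith
  have hmain := pow_mul_card_mul_le G hs hβ hκ h0 h1 (d := δ * n) (by positivity)
    (φ := sineArch m r μ) (sineArch_nonneg hμ0) (fun k => sineArch_eq_zero) hrn
    (sineArch_pos hμ0 (by omega) le_rfl)
    (fun k hk => mul_sineArch_le_krawOp hs hρ hρ1 hr hr' hmr hk)
    (by
      have : 0 < ε * n := by positivity
      linarith) hS
  have hvol := sum_pow_card_le_exp (by linarith) hρ hρs hr
  rw [div_mul_eq_mul_div, le_div_iff₀ hε0]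
  refine le_of_mul_le_mul_right ?_ hn0'
  calc κ ^ n * #S * ε * n = κ ^ n * #S * (ε * n) := by ring
    _ ≤ κ ^ n * #S * (n * L - m * (2 * μ + (s - 2)) - ((s - 1) * n - s * (δ * n))) := by gcongr
    _ ≤ s * (δ * n) * ∑ a : Finset (Fin n) with #a ≤ r, (s - 1) ^ #a := hmain
    _ ≤ s * (δ * n) * exp (n * CycleCodes.Hq s ρ) := by gcongr
    _ = _ := by ring

theorem rate_le_of_eventually_le {V : Type*} (G : SimpleGraph V) {δ B : ℝ}
    (h : ∀ᶠ n : ℕ in atTop,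
      1 / (n : ℝ) * log ((CycleCodes.powGraph G n (δ * n)).indepNum : ℝ) ≤ B) :
    CycleCodes.rate G δ ≤ B := by
  refine limsup_le_of_le ?_ h
  refine isCoboundedUnder_le_of_le atTop (x := 0) fun n => ?_
  exact mul_nonneg (by positivity) (log_natCast_nonneg _)

theorem one_le_indepNum {W : Type*} [Fintype W] [Nonempty W] (G : SimpleGraph W) :
    1 ≤ G.indepNum := by
  obtain ⟨x⟩ := ‹Nonempty W›
  have h : G.IsIndepSet (({x} : Finset W) : Set W) := by simp
  simpa using h.card_le_indepNum

/-- The bound at an arbitrary admissible radius `ρ`; the constant factor in the size of the code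
disappears in the limit. -/
theorem rate_le_add_Hq {V : Type*} [Fintype V] [Nonempty V] [DecidableEq V] (G : SimpleGraph V)
    [DecidableRel G.Adj] {s β κ δ ρ : ℝ} (hs : 2 ≤ s) (hβ : 0 ≤ β) (hκ : 0 < κ)
    (h0 : (1 + β • G.adjMatrix ℝ - Matrix.of fun _ _ => κ).PosSemidef)
    (h1 : ((s - 1) • (1 : Matrix V V ℝ) - β • G.adjMatrix ℝ).PosSemidef)
    (hδ : 0 < δ) (hρ : 0 < ρ) (hρs : ρ ≤ 1 - 1 / s)
    (hlt : (s - 1) - s * δ < 2 * √((s - 1) * ρ * (1 - ρ)) + ρ * (s - 2)) :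
    CycleCodes.rate G δ ≤ -log κ + CycleCodes.Hq s ρ := by
  obtain ⟨C, hC, hev⟩ := exists_eventually_card_le G hs hβ hκ.le h0 h1 hδ hρ hρs hlt
  refine le_of_forall_pos_le_add fun η hη => rate_le_of_eventually_le G ?_
  have e1 : ∀ᶠ n : ℕ in atTop, log C ≤ η * n :=
    (tendsto_natCast_atTop_atTop.const_mul_atTop hη).eventually_ge_atTop _
  filter_upwards [hev, e1, eventually_gt_atTop 0] with n hn hn1 hn0
  have hn0' : (0 : ℝ) < n := by exact_mod_cast hn0
  obtain ⟨S, hS⟩ := (CycleCodes.powGraph G n (δ * n)).exists_isNIndepSet_indepNum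
  have h := hn S hS.isIndepSet
  rw [hS.card_eq] at h
  have hpos : (0 : ℝ) < (CycleCodes.powGraph G n (δ * n)).indepNum := by
    exact_mod_cast one_le_indepNum _
  have h2 := log_le_log (by positivity) h
  rw [log_mul (by positivity) (by positivity), log_mul (by positivity) (by positivity), log_exp,
    log_pow] at h2
  rw [one_div, inv_mul_le_iff₀ hn0']
  nlinarith

theorem rate_le_log_card {V : Type*} [Fintype V] [Nonempty V] (G : SimpleGraph V) (δ : ℝ) :
    CycleCodes.rate G δ ≤ log (Fintype.card V) := by
  refine rate_le_of_eventually_le G ?_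
  filter_upwards [eventually_gt_atTop 0] with n hn0
  have hn0' : (0 : ℝ) < n := by exact_mod_cast hn0
  obtain ⟨S, hS⟩ := (CycleCodes.powGraph G n (δ * n)).exists_isNIndepSet_indepNum
  have hpos : (0 : ℝ) < (CycleCodes.powGraph G n (δ * n)).indepNum := by
    exact_mod_cast one_le_indepNum _
  have hcard : (CycleCodes.powGraph G n (δ * n)).indepNum ≤ Fintype.card V ^ n := by
    classical
    rw [← hS.card_eq]
    simpa using card_le_univ S
  have h2 := log_le_log hpos (by exact_mod_cast hcard : _ ≤ (Fintype.card V : ℝ) ^ n)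
  rw [log_pow] at h2
  rwa [one_div, inv_mul_le_iff₀ hn0']

/-! ### The optimal radius -/

/-- `sin ^ 2 (γ₀ - γ)` in terms of `ρ = sin ^ 2 γ`, where `sin ^ 2 γ₀ = 1 - 1 / s`. -/
theorem sub_sq_eq {s ρ : ℝ} (hs : 1 ≤ s) (hρ : 0 ≤ ρ) (hρ1 : ρ ≤ 1) :
    (√(s - 1) * √(1 - ρ) - √ρ) ^ 2 =
      (s - 1) - (s - 2) * ρ - 2 * √((s - 1) * ρ * (1 - ρ)) := by
  have e : √((s - 1) * ρ * (1 - ρ)) = √(s - 1) * √ρ * √(1 - ρ) := by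
    rw [sqrt_mul (mul_nonneg (by linarith) hρ), sqrt_mul (by linarith)]
  rw [e]
  linear_combination √(1 - ρ) ^ 2 * sq_sqrt (show 0 ≤ s - 1 by linarith) +
    (s - 1) * sq_sqrt (show 0 ≤ 1 - ρ by linarith) + sq_sqrt hρ

theorem sqrt_lt_mul_sqrt {s ρ : ℝ} (hs : 1 < s) (hρ : 0 ≤ ρ) (hρs : ρ < 1 - 1 / s) :
    √ρ < √(s - 1) * √(1 - ρ) := by
  rw [← sqrt_mul (by linarith)]
  refine sqrt_lt_sqrt hρ ?_
  rw [lt_sub_iff_add_lt, ← lt_sub_iff_add_lt', div_lt_iff₀ (by linarith)] at hρs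
  nlinarith

/-- The radius at which the entropy function is evaluated in the first linear programming
bound. -/
noncomputable def optimalRadius (s δ : ℝ) : ℝ :=
  if δ < 1 - 1 / s then ((s - 1) - (s - 2) * δ - 2 * √((s - 1) * δ * (1 - δ))) / s else 0

theorem RLP1_eq_Hq_optimalRadius (s δ : ℝ) :
    CycleCodes.RLP1 s δ = CycleCodes.Hq s (optimalRadius s δ) := by
  unfold CycleCodes.RLP1 optimalRadius
  split_ifs
  · rfl
  · simp [CycleCodes.Hq]

theorem optimalRadius_eq {s δ : ℝ} (hs : 1 < s) (hδ : 0 ≤ δ) (h : δ < 1 - 1 / s) :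
    s * optimalRadius s δ = (√(s - 1) * √(1 - δ) - √δ) ^ 2 := by
  have h1 : 0 < 1 / s := by
    have : 0 < s := by linarith
    positivity
  rw [sub_sq_eq hs.le hδ (by linarith), optimalRadius, if_pos h, mul_div_cancel₀ _ (by linarith)]

theorem optimalRadius_nonneg {s δ : ℝ} (hs : 1 < s) (hδ : 0 ≤ δ) : 0 ≤ optimalRadius s δ := by
  by_cases h : δ < 1 - 1 / s
  · have := optimalRadius_eq hs hδ h
    refine nonneg_of_mul_nonneg_right (a := s) ?_ (by linarith)
    rw [this]
    positivity
  · rw [optimalRadius, if_neg h]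

theorem optimalRadius_lt {s δ : ℝ} (hs : 1 < s) (hδ : 0 < δ) :
    optimalRadius s δ < 1 - 1 / s := by
  have hs0 : 0 < s := by linarith
  by_cases h : δ < 1 - 1 / s
  · have h1 := optimalRadius_eq hs hδ.le h
    have h2 := sqrt_lt_mul_sqrt hs hδ.le h
    have h3 : √(1 - δ) ≤ 1 := by
      rw [sqrt_le_one]
      linarith
    have h4 : 0 < √δ := sqrt_pos.2 hδ
    have h5 := sq_sqrt (show 0 ≤ s - 1 by linarith)
    have h7 : (√(s - 1) * √(1 - δ) - √δ) ^ 2 < √(s - 1) ^ 2 := by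
      refine pow_lt_pow_left₀ ?_ (by linarith) two_ne_zero
      nlinarith [sqrt_nonneg (s - 1)]
    have h6 : s * optimalRadius s δ < s * (1 - 1 / s) := by
      rw [h1, mul_sub, mul_one_div_cancel hs0.ne', mul_one]
      exact h7.trans_eq h5
    exact lt_of_mul_lt_mul_left h6 hs0.le
  · rw [optimalRadius, if_neg h, sub_pos, div_lt_one hs0]
    exact hs

/-- Radii above the optimal one are admissible in the linear programming bound. -/
theorem lt_of_optimalRadius_lt {s δ ρ : ℝ} (hs : 1 < s) (hδ : 0 < δ) (h : optimalRadius s δ < ρ)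
    (hρs : ρ < 1 - 1 / s) :
    (s - 1) - s * δ < 2 * √((s - 1) * ρ * (1 - ρ)) + ρ * (s - 2) := by
  have hs0 : 0 < s := by linarith
  have hρ0 : 0 < ρ := (optimalRadius_nonneg hs hδ.le).trans_lt h
  have hs' : 0 < 1 / s := by positivity
  have hlt := sqrt_lt_mul_sqrt hs hρ0.le hρs
  suffices hsq : (√(s - 1) * √(1 - ρ) - √ρ) ^ 2 < s * δ by
    rw [sub_sq_eq hs.le hρ0.le (by linarith)] at hsq
    linarith
  have hk := sq_sqrt (show 0 ≤ s - 1 by linarith)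
  have hb := sq_sqrt (show 0 ≤ 1 - ρ by linarith)
  have ha := sq_sqrt hρ0.le
  have hk0 : 0 < √(s - 1) := sqrt_pos.2 (by linarith)
  by_cases hδs : δ < 1 - 1 / s
  · have h1 := optimalRadius_eq hs hδ.le hδs
    have h2 := sqrt_lt_mul_sqrt hs hδ.le hδs
    have hd := sq_sqrt hδ.le
    have hd' := sq_sqrt (show 0 ≤ 1 - δ by linarith)
    have hS := sq_sqrt hs0.le
    have hS0 : 0 < √s := sqrt_pos.2 hs0
    -- the radius `ρ` is larger than the optimal one, and `1 - ρ` is smaller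
    have g1 : √(s - 1) * √(1 - δ) - √δ < √s * √ρ := by
      refine lt_of_pow_lt_pow_left₀ 2 (by positivity) ?_
      rw [← h1, mul_pow, hS, ha]
      gcongr
    have g2 : √s * √(1 - ρ) < √(1 - δ) + √(s - 1) * √δ := by
      refine lt_of_pow_lt_pow_left₀ 2 (by positivity) ?_
      have h3 : (√(1 - δ) + √(s - 1) * √δ) ^ 2 = s - s * optimalRadius s δ := by
        rw [h1]
        linear_combination (√δ ^ 2 + √(1 - δ) ^ 2) * hk + s * hd + s * hd'
      rw [h3, mul_pow, hS, hb]
      nlinarith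
    have g3 : √s * (√(s - 1) * √(1 - ρ) - √ρ) < √s * (√s * √δ) := by
      have := mul_lt_mul_of_pos_left g2 hk0
      have e : √s * (√s * √δ) = √δ + √(s - 1) ^ 2 * √δ := by
        rw [hk, ← mul_assoc, ← sq, hS]
        ring
      rw [e]
      nlinarith
    have g4 := lt_of_mul_lt_mul_left g3 hS0.le
    calc _ < (√s * √δ) ^ 2 := pow_lt_pow_left₀ g4 (by linarith) two_ne_zero
      _ = s * δ := by rw [mul_pow, hS, hd]
  · have h1 : s - 1 ≤ s * δ := by
      have := mul_le_mul_of_nonneg_left (not_lt.1 hδs) hs0.le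
      rwa [mul_sub, mul_one_div_cancel hs0.ne', mul_one] at this
    refine lt_of_lt_of_le ?_ (hk.le.trans h1)
    refine pow_lt_pow_left₀ ?_ (by linarith) two_ne_zero
    have h3 : √(1 - ρ) ≤ 1 := by
      rw [sqrt_le_one]
      linarith
    have := sqrt_pos.2 hρ0
    nlinarith

theorem continuous_Hq (s : ℝ) : Continuous (CycleCodes.Hq s) := by
  unfold CycleCodes.Hq
  have h := continuous_mul_log
  have h2 : Continuous fun x : ℝ => (1 - x) * log (1 - x) :=
    h.comp (continuous_const.sub continuous_id)
  exact ((continuous_id.mul continuous_const).sub h).sub h2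

theorem RLP1_zero {s : ℝ} (hs : 1 < s) : CycleCodes.RLP1 s 0 = log s := by
  have hs0 : 0 < s := by linarith
  have h : (0 : ℝ) < 1 - 1 / s := by
    rw [sub_pos, div_lt_one hs0]
    exact hs
  rw [CycleCodes.RLP1, if_pos h, CycleCodes.Hq]
  have e : (s - 1 - (s - 2) * 0 - 2 * √((s - 1) * 0 * (1 - 0))) / s = (s - 1) / s := by simp
  have e2 : 1 - (s - 1) / s = 1 / s := by
    field_simp
    ring
  rw [e, e2, log_div (by linarith) hs0.ne', log_div one_ne_zero hs0.ne', log_one]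
  field_simp
  ring

/-- The rate bound for a graph whose adjacency matrix satisfies the two spectral conditions of the
linear programming bound. -/
theorem rate_le_add_RLP1 {V : Type*} [Fintype V] [Nonempty V] [DecidableEq V] (G : SimpleGraph V)
    [DecidableRel G.Adj] {s β δ : ℝ} (hs : 2 ≤ s) (hβ : 0 ≤ β)
    (h0 : (1 + β • G.adjMatrix ℝ - Matrix.of fun _ _ => s / Fintype.card V).PosSemidef)
    (h1 : ((s - 1) • (1 : Matrix V V ℝ) - β • G.adjMatrix ℝ).PosSemidef) (hδ : 0 ≤ δ) :
    CycleCodes.rate G δ ≤ log (Fintype.card V / s) + CycleCodes.RLP1 s δ := by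
  have hs0 : 0 < s := by linarith
  have hV : (0 : ℝ) < Fintype.card V := by exact_mod_cast Fintype.card_pos
  rcases hδ.eq_or_lt with rfl | hδ
  · rw [RLP1_zero (by linarith), log_div hV.ne' hs0.ne', sub_add_cancel]
    exact rate_le_log_card G 0
  · rw [RLP1_eq_Hq_optimalRadius]
    have hlim : Tendsto (fun ρ => log (Fintype.card V / s) + CycleCodes.Hq s ρ)
        (𝓝[>] optimalRadius s δ)
        (𝓝 (log (Fintype.card V / s) + CycleCodes.Hq s (optimalRadius s δ))) :=
      ((continuous_const.add (continuous_Hq s)).tendsto _).mono_left nhdsWithin_le_nhds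
    refine ge_of_tendsto hlim ?_
    filter_upwards [Ioo_mem_nhdsGT (optimalRadius_lt (by linarith) hδ)] with ρ hρ
    have h := rate_le_add_Hq G hs hβ (by positivity) h0 h1 hδ
      ((optimalRadius_nonneg (by linarith) hδ.le).trans_lt hρ.1) hρ.2.le
      (lt_of_optimalRadius_lt (by linarith) hδ hρ.1 hρ.2)
    rwa [← log_inv, inv_div] at h

/-! ### Codes on odd cycles -/

theorem rate_cycleGraph_le {q : ℕ} (hodd : Odd q) (hq : 3 ≤ q) {δ : ℝ} (hδ : 0 ≤ δ) :
    CycleCodes.rate (SimpleGraph.cycleGraph q) δ ≤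
      log (q / CycleCodes.qprime q) + CycleCodes.RLP1 (CycleCodes.qprime q) δ := by
  have hs := two_lt_qprime hq
  have : Nonempty (Fin q) := ⟨⟨0, by omega⟩⟩
  have h := rate_le_add_RLP1 (SimpleGraph.cycleGraph q) (s := CycleCodes.qprime q)
    (β := (CycleCodes.qprime q - 1) / 2) hs.le (by linarith)
    (by rw [Fintype.card_fin]; exact cycle_theta_kernel_posSemidef hodd hq)
    (cycle_complementary_kernel_posSemidef hq) hδ
  rwa [Fintype.card_fin] at h

theorem qprime_le_three {q : ℕ} (hq : 3 ≤ q) : CycleCodes.qprime q ≤ 3 := by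
  have h := one_half_le_cos_pi_div hq
  have : 1 / cos (π / q) ≤ 2 := by
    rw [div_le_iff₀ (by linarith)]
    linarith
  unfold CycleCodes.qprime
  linarith

theorem qprime_lt_three {q : ℕ} (hq : 3 < q) : CycleCodes.qprime q < 3 := by
  have h3 : (3 : ℝ) < q := by exact_mod_cast hq
  have h : 1 / 2 < cos (π / q) := by
    rw [← cos_pi_div_three]
    refine cos_lt_cos_of_nonneg_of_le_pi (by positivity) ?_ ?_
    · linarith [pi_pos]
    · have := pi_pos
      gcongr
  have : 1 / cos (π / q) < 2 := by
    rw [div_lt_iff₀ (by linarith)]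
    linarith
  unfold CycleCodes.qprime
  linarith

theorem qprime_five : CycleCodes.qprime 5 = √5 := by
  have h5 : √5 ^ 2 = 5 := sq_sqrt (by norm_num)
  have h0 : 0 < 1 + √5 := by positivity
  rw [CycleCodes.qprime, Nat.cast_ofNat, cos_pi_div_five]
  field_simp
  linear_combination -h5

end

theorem theorem1 :
    (∀ q : ℕ, Odd q → 3 ≤ q →
      CycleCodes.qprime q ≤ (q : ℝ) ∧
      (3 < q → ∀ m : ℤ, CycleCodes.qprime q ≠ (m : ℝ)) ∧
      ∀ δ : ℝ, 0 ≤ δ →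
        CycleCodes.rate (SimpleGraph.cycleGraph q) δ ≤
          Real.log (CycleCodes.thetaL (SimpleGraph.cycleGraph q)) +
            CycleCodes.RLP1 (CycleCodes.qprime q) δ) ∧
    CycleCodes.qprime 5 = √5 ∧
    (∀ δ : ℝ, 0 ≤ δ →
      CycleCodes.rate (SimpleGraph.cycleGraph 5) δ ≤
        1 / 2 * Real.log 5 + CycleCodes.RLP1 √5 δ) := by
  refine ⟨fun q hodd hq => ⟨?_, ?_, ?_⟩, qprime_five, ?_⟩
  · have : (3 : ℝ) ≤ q := by exact_mod_cast hq
    exact (qprime_le_three hq).trans this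
  · intro hq3 m hm
    have h2 := two_lt_qprime hq
    have h3 := qprime_lt_three hq3
    rw [hm] at h2 h3
    have h2' : 2 < m := by exact_mod_cast h2
    have h3' : m < 3 := by exact_mod_cast h3
    omega
  · intro δ hδ
    have hs := two_lt_qprime hq
    have hq0 : (0 : ℝ) < q := by positivity
    have h := Real.log_le_log (by positivity) (div_qprime_le_thetaL hodd hq)
    linarith [rate_cycleGraph_le hodd hq hδ]
  · intro δ hδ
    have h := rate_cycleGraph_le (q := 5) (by decide) (by norm_num) hδ
    rw [qprime_five, Nat.cast_ofNat, Real.div_sqrt, Real.log_sqrt (by norm_num)] at h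
    linarith
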